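/- For each integer $n \ge 0$ let $A(n) = \sum_{k=0}^{n} \binom{n}{k}^2 \binom{n+k}{k}^2$ be the $n$-th Apéry number, and let $e_2(n)$ be the number of $2$s in the standard base-$5$ representation of $n$. If the standard base-$5$ representation of $n$ contains no digit $1$ and no digit $3$, then $$A(n) \equiv (-2)^{e_2(n)} \pmod{25}.$$ -/

import Mathlib

/-- The Apéry numbers `A(n) = ∑_{k=0}^n C(n,k)^2 C(n+k,k)^2`. -/
def aperyNumber (n : ℕ) : ℕ :=
  ∑ k ∈ Finset.range (n + 1), n.choose k ^ 2 * (n + k).choose k ^ 2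

/-! Modulo 25, `A(5n+d) ≡ c_d A(n)` with `c_0 = c_4 = 1` and `c_2 = -2`; induction on the base-5
digits finishes. The congruence holds term by term: the summands at `5k, ..., 5k+4` add up to `c_d`
times the summand of `A(n)` at `k`. Binomials enter squared, so those that Lucas makes divisible by
5 vanish; each other one is `C(n,k)` (or `C(n+k,k)`) times an explicit factor. Writing `n = k + m`
avoids subtraction. -/

theorem five_dvd_choose_of_mod_lt {a b : ℕ} (h : a % 5 < b % 5) : 5 ∣ a.choose b := by
  have : Fact (Nat.Prime 5) := ⟨by norm_num⟩
  have := Choose.choose_modEq_choose_mod_mul_choose_div_nat (n := a) (k := b) (p := 5)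
  rw [Nat.choose_eq_zero_of_lt h, zero_mul] at this
  exact (Nat.modEq_zero_iff_dvd).1 this

theorem twentyFive_eq_zero : (25 : ZMod 25) = 0 := by decide

theorem cast_sq_eq_zero_of_five_dvd {a : ℕ} (h : 5 ∣ a) : (a : ZMod 25) ^ 2 = 0 := by
  obtain ⟨c, rfl⟩ := h
  push_cast
  linear_combination (c : ZMod 25) ^ 2 * twentyFive_eq_zero

/-- Vandermonde with five new elements: the inner coefficients 5, 10, 10, 5 meet binomials divisible
by 5, so only Pascal's rule for `n`, `k` survives. -/
theorem cast_choose_five_mul (n k : ℕ) :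
    ((5 * n).choose (5 * k) : ZMod 25) = (n.choose k : ZMod 25) := by
  induction n generalizing k with
  | zero => cases k <;> simp [Nat.mul_succ]
  | succ n ih =>
    cases k with
    | zero => simp
    | succ k =>
      have h0 := ih k
      have h5 := ih (k + 1)
      obtain ⟨c1, h1⟩ := five_dvd_choose_of_mod_lt (a := 5 * n) (b := 5 * k + 1) (by omega)
      obtain ⟨c2, h2⟩ := five_dvd_choose_of_mod_lt (a := 5 * n) (b := 5 * k + 2) (by omega)
      obtain ⟨c3, h3⟩ := five_dvd_choose_of_mod_lt (a := 5 * n) (b := 5 * k + 3) (by omega)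
      obtain ⟨c4, h4⟩ := five_dvd_choose_of_mod_lt (a := 5 * n) (b := 5 * k + 4) (by omega)
      have hexp : (5 * (n + 1)).choose (5 * (k + 1)) =
          (5 * n).choose (5 * k) + 5 * (5 * n).choose (5 * k + 1)
          + 10 * (5 * n).choose (5 * k + 2) + 10 * (5 * n).choose (5 * k + 3)
          + 5 * (5 * n).choose (5 * k + 4) + (5 * n).choose (5 * (k + 1)) := by
        rw [show 5 * (n + 1) = 5 * n + 1 + 1 + 1 + 1 + 1 by ring,
          show 5 * (k + 1) = 5 * k + 1 + 1 + 1 + 1 + 1 by ring]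
        simp only [Nat.choose_succ_succ']
        ring
      rw [hexp, Nat.choose_succ_succ', h1, h2, h3, h4]
      push_cast
      rw [h0, h5]
      linear_combination (c1 + 2 * c2 + 2 * c3 + c4 : ZMod 25) * twentyFive_eq_zero

theorem choose_add_left_mul (a b : ℕ) :
    (a + b).choose b * (a + b + 1) = (a + b + 1).choose b * (a + 1) := by
  rw [Nat.choose_mul_succ_eq]
  congr 1
  omega

theorem cast_choose_five_mul_add_two_self (k m : ℕ) :
    ((5 * (k + m) + 2).choose (5 * k) : ZMod 25) = (k + m).choose k * (1 + 20 * k) := by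
  have h0 := cast_choose_five_mul (k + m) k
  have h1 := congrArg (Nat.cast (R := ZMod 25)) (choose_add_left_mul (5 * m) (5 * k))
  have h2 := congrArg (Nat.cast (R := ZMod 25)) (choose_add_left_mul (5 * m + 1) (5 * k))
  rw [show 5 * m + 5 * k = 5 * (k + m) by ring] at h1
  rw [show 5 * m + 1 + 5 * k = 5 * (k + m) + 1 by ring] at h2
  push_cast at h1 h2
  rw [h0] at h1
  set X : ZMod 25 := (((5 * (k + m) + 2).choose (5 * k) : ℕ) : ZMod 25)
  set Y : ZMod 25 := (((5 * (k + m) + 1).choose (5 * k) : ℕ) : ZMod 25)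
  set C : ZMod 25 := (((k + m).choose k : ℕ) : ZMod 25)
  have hX : X * ((5 * m + 1) * (5 * m + 2)) =
      C * ((5 * (k + m) + 1) * (5 * (k + m) + 2)) := by
    linear_combination (-(5 * m + 1) : ZMod 25) * h2 - (5 * (k + m) + 2 : ZMod 25) * h1
  -- `13 - 10m` inverts `(5m+1)(5m+2) ≡ 2 + 15m`.
  have hu : ((5 * m + 1) * (5 * m + 2) * (13 - 10 * m) : ZMod 25) = 1 := by
    linear_combination (1 + 7 * m + 7 * m ^ 2 - 10 * m ^ 3 : ZMod 25) * twentyFive_eq_zero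
  have hv : ((5 * (k + m) + 1) * (5 * (k + m) + 2) * (13 - 10 * m) : ZMod 25)
      = 1 + 20 * k := by
    linear_combination (1 + 7 * (k + m) + 13 * (k + m) ^ 2 - 6 * m * (k + m)
      - 10 * m * (k + m) ^ 2 : ZMod 25) * twentyFive_eq_zero
  linear_combination (-X) * hu + (13 - 10 * m : ZMod 25) * hX + C * hv

/-- The factor `1 + 20k` cancels because `(5x+1)(5x+2)(5x+3)(5x+4) ≡ -1` for every `x`. -/
theorem cast_choose_five_mul_add_four_self (k m : ℕ) :
    ((5 * (k + m) + 4).choose (5 * k) : ZMod 25) = (k + m).choose k := by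
  have h0 := cast_choose_five_mul_add_two_self k m
  have h3 := congrArg (Nat.cast (R := ZMod 25)) (choose_add_left_mul (5 * m + 2) (5 * k))
  have h4 := congrArg (Nat.cast (R := ZMod 25)) (choose_add_left_mul (5 * m + 3) (5 * k))
  rw [show 5 * m + 2 + 5 * k = 5 * (k + m) + 2 by ring] at h3
  rw [show 5 * m + 3 + 5 * k = 5 * (k + m) + 3 by ring] at h4
  push_cast at h3 h4
  rw [h0] at h3
  set X : ZMod 25 := (((5 * (k + m) + 4).choose (5 * k) : ℕ) : ZMod 25)
  set Y : ZMod 25 := (((5 * (k + m) + 3).choose (5 * k) : ℕ) : ZMod 25)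
  set C : ZMod 25 := (((k + m).choose k : ℕ) : ZMod 25)
  have hX : X * ((5 * m + 3) * (5 * m + 4)) =
      C * (1 + 20 * k) * ((5 * (k + m) + 3) * (5 * (k + m) + 4)) := by
    linear_combination (-(5 * m + 3) : ZMod 25) * h4 - (5 * (k + m) + 4 : ZMod 25) * h3
  have hu : ∀ m : ZMod 25, (5 * m + 3) * (5 * m + 4) * (-2 + 10 * m) = 1 := by decide
  have hv : ∀ k m : ZMod 25,
      (1 + 20 * k) * ((5 * (k + m) + 3) * (5 * (k + m) + 4)) * (-2 + 10 * m) = 1 := by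
    decide
  linear_combination (-X) * hu m + (-2 + 10 * m : ZMod 25) * hX + C * hv k m

theorem cast_choose_five_mul_add_two_add_one (k m : ℕ) :
    ((5 * (k + m) + 2).choose (5 * k + 1) : ZMod 25) =
      (k + m).choose k * ((1 + 20 * k) * (5 * m + 2) * (1 - 5 * k)) := by
  have h0 := cast_choose_five_mul_add_two_self k m
  have h1 := congrArg (Nat.cast (R := ZMod 25))
    (Nat.choose_succ_right_eq (5 * (k + m) + 2) (5 * k))
  rw [show 5 * (k + m) + 2 - 5 * k = 5 * m + 2 by omega] at h1
  push_cast at h1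
  rw [h0] at h1
  linear_combination (1 - 5 * k : ZMod 25) * h1 +
    ((5 * (k + m) + 2).choose (5 * k + 1) * k ^ 2 : ZMod 25) * twentyFive_eq_zero

theorem cast_choose_five_mul_add_two_add_two (k m : ℕ) :
    ((5 * (k + m) + 2).choose (5 * k + 2) : ZMod 25) =
      (k + m).choose k *
        ((1 + 20 * k) * (5 * m + 2) * (1 - 5 * k) * (5 * m + 1) * (13 + 5 * k)) := by
  have h0 := cast_choose_five_mul_add_two_add_one k m
  have h1 := congrArg (Nat.cast (R := ZMod 25))
    (Nat.choose_succ_right_eq (5 * (k + m) + 2) (5 * k + 1))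
  rw [show 5 * (k + m) + 2 - (5 * k + 1) = 5 * m + 1 by omega] at h1
  push_cast at h1
  rw [h0] at h1
  have hu : ∀ k : ZMod 25, (5 * k + 1 + 1) * (13 + 5 * k) = 1 := by decide
  linear_combination (13 + 5 * k : ZMod 25) * h1 -
    ((5 * (k + m) + 2).choose (5 * k + 2) : ZMod 25) * hu k

theorem cast_choose_five_mul_add_three_add_one (k m : ℕ) :
    ((5 * (k + m) + 3).choose (5 * k + 1) : ZMod 25) =
      (k + m).choose k * ((1 + 20 * k) * (5 * (k + m) + 3) * (1 - 5 * k)) := by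
  have h0 := cast_choose_five_mul_add_two_self k m
  have h1 := congrArg (Nat.cast (R := ZMod 25))
    (Nat.add_one_mul_choose_eq (5 * (k + m) + 2) (5 * k))
  push_cast at h1
  rw [h0] at h1
  linear_combination (-(1 - 5 * k) : ZMod 25) * h1 +
    ((5 * (k + m) + 3).choose (5 * k + 1) * k ^ 2 : ZMod 25) * twentyFive_eq_zero

theorem cast_choose_five_mul_add_four_add_two (k m : ℕ) :
    ((5 * (k + m) + 4).choose (5 * k + 2) : ZMod 25) =
      (k + m).choose k * ((1 + 20 * k) * (5 * (k + m) + 3) * (1 - 5 * k) *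
        (5 * (k + m) + 4) * (13 + 5 * k)) := by
  have h0 := cast_choose_five_mul_add_three_add_one k m
  have h1 := congrArg (Nat.cast (R := ZMod 25))
    (Nat.add_one_mul_choose_eq (5 * (k + m) + 3) (5 * k + 1))
  push_cast at h1
  rw [h0] at h1
  have hu : ∀ k : ZMod 25, (5 * k + 1 + 1) * (13 + 5 * k) = 1 := by decide
  linear_combination (-(13 + 5 * k) : ZMod 25) * h1 -
    ((5 * (k + m) + 4).choose (5 * k + 2) : ZMod 25) * hu k

/-- The summand of the Apéry number `A(n)`, reduced modulo `25`. -/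
def aperyTerm (n k : ℕ) : ZMod 25 :=
  (n.choose k : ZMod 25) ^ 2 * ((n + k).choose k : ZMod 25) ^ 2

theorem cast_aperyNumber (n : ℕ) :
    (aperyNumber n : ZMod 25) = ∑ k ∈ Finset.range (n + 1), aperyTerm n k := by
  simp [aperyNumber, aperyTerm]

theorem sum_range_five_mul {M : Type*} [AddCommMonoid M] (f : ℕ → M) (n : ℕ) :
    ∑ i ∈ Finset.range (5 * n), f i =
      ∑ k ∈ Finset.range n, ∑ j ∈ Finset.range 5, f (5 * k + j) := by
  induction n with
  | zero => simp
  | succ n ih =>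
    rw [Finset.sum_range_succ, ← ih, Nat.mul_succ, Finset.sum_range_add]

theorem cast_aperyNumber_five_mul_add {d : ℕ} (hd : d < 5) (n : ℕ) :
    (aperyNumber (5 * n + d) : ZMod 25) =
      ∑ k ∈ Finset.range (n + 1), ∑ j ∈ Finset.range 5, aperyTerm (5 * n + d) (5 * k + j) := by
  rw [cast_aperyNumber, ← sum_range_five_mul]
  refine Finset.sum_subset (Finset.range_subset_range.2 (by omega)) fun k _ hk => ?_
  rw [Finset.mem_range, not_lt] at hk
  simp [aperyTerm, Nat.choose_eq_zero_of_lt (show 5 * n + d < k by omega)]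

theorem aperyTerm_eq_zero_of_lt {n k : ℕ} (h : n % 5 < k % 5) : aperyTerm n k = 0 := by
  rw [aperyTerm, cast_sq_eq_zero_of_five_dvd (five_dvd_choose_of_mod_lt h), zero_mul]

/-- Needed for last digit 4, where `C(n,k)` need not vanish modulo 5 but adding a nonzero last digit
of `k` carries. -/
theorem aperyTerm_eq_zero_of_add_lt {n k : ℕ} (h : (n + k) % 5 < k % 5) :
    aperyTerm n k = 0 := by
  rw [aperyTerm, cast_sq_eq_zero_of_five_dvd (five_dvd_choose_of_mod_lt h), mul_zero]

theorem cast_aperyNumber_five_mul (n : ℕ) :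
    (aperyNumber (5 * n) : ZMod 25) = aperyNumber n := by
  have h := cast_aperyNumber_five_mul_add (d := 0) (by norm_num) n
  rw [add_zero] at h
  rw [h, cast_aperyNumber]
  refine Finset.sum_congr rfl fun k _ => ?_
  simp only [Finset.sum_range_succ, Finset.sum_range_zero, zero_add, add_zero]
  rw [aperyTerm_eq_zero_of_lt (k := 5 * k + 1) (by omega),
    aperyTerm_eq_zero_of_lt (k := 5 * k + 2) (by omega),
    aperyTerm_eq_zero_of_lt (k := 5 * k + 3) (by omega),
    aperyTerm_eq_zero_of_lt (k := 5 * k + 4) (by omega)]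
  simp only [aperyTerm, ← mul_add, cast_choose_five_mul, add_zero]

theorem cast_aperyNumber_five_mul_add_four (n : ℕ) :
    (aperyNumber (5 * n + 4) : ZMod 25) = aperyNumber n := by
  rw [cast_aperyNumber_five_mul_add (by norm_num), cast_aperyNumber]
  refine Finset.sum_congr rfl fun k hk => ?_
  obtain ⟨m, rfl⟩ := Nat.exists_eq_add_of_le (Nat.lt_succ_iff.1 (Finset.mem_range.1 hk))
  simp only [Finset.sum_range_succ, Finset.sum_range_zero, zero_add, add_zero]
  rw [aperyTerm_eq_zero_of_add_lt (k := 5 * k + 1) (by omega),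
    aperyTerm_eq_zero_of_add_lt (k := 5 * k + 2) (by omega),
    aperyTerm_eq_zero_of_add_lt (k := 5 * k + 3) (by omega),
    aperyTerm_eq_zero_of_add_lt (k := 5 * k + 4) (by omega)]
  have h := cast_choose_five_mul_add_four_self k (k + m)
  rw [show 5 * (k + (k + m)) + 4 = 5 * (k + m) + 4 + 5 * k by ring] at h
  simp only [aperyTerm, cast_choose_five_mul_add_four_self, h, add_zero]
  rw [add_comm (k + m) k]

theorem cast_aperyNumber_five_mul_add_two (n : ℕ) :
    (aperyNumber (5 * n + 2) : ZMod 25) = -2 * aperyNumber n := by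
  rw [cast_aperyNumber_five_mul_add (by norm_num), cast_aperyNumber, Finset.mul_sum]
  refine Finset.sum_congr rfl fun k hk => ?_
  obtain ⟨m, rfl⟩ := Nat.exists_eq_add_of_le (Nat.lt_succ_iff.1 (Finset.mem_range.1 hk))
  simp only [Finset.sum_range_succ, Finset.sum_range_zero, zero_add, add_zero]
  rw [aperyTerm_eq_zero_of_lt (k := 5 * k + 3) (by omega),
    aperyTerm_eq_zero_of_lt (k := 5 * k + 4) (by omega)]
  -- For `j = 0, 1, 2` the upper index of the second binomial ends in `2 + j`, without a carry.
  have h0 := cast_choose_five_mul_add_two_self k (k + m)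
  have h1 := cast_choose_five_mul_add_three_add_one k (k + m)
  have h2 := cast_choose_five_mul_add_four_add_two k (k + m)
  rw [show 5 * (k + (k + m)) + 2 = 5 * (k + m) + 2 + 5 * k by ring] at h0
  rw [show 5 * (k + (k + m)) + 3 = 5 * (k + m) + 2 + (5 * k + 1) by ring] at h1
  rw [show 5 * (k + (k + m)) + 4 = 5 * (k + m) + 2 + (5 * k + 2) by ring] at h2
  simp only [aperyTerm, h0, h1, h2, cast_choose_five_mul_add_two_self,
    cast_choose_five_mul_add_two_add_one, cast_choose_five_mul_add_two_add_two, add_zero]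
  rw [add_comm (k + m) k]
  -- The three surviving summands over their common binomials; the dependence on `k` and `m`
  -- cancels.
  have key : ∀ k m : ZMod 25,
      (1 + 20 * k) ^ 4 * (1 + (1 - 5 * k) ^ 4 * (5 * m + 2) ^ 2 * (5 * (k + (k + m)) + 3) ^ 2 *
        (1 + (13 + 5 * k) ^ 4 * (5 * m + 1) ^ 2 * (5 * (k + (k + m)) + 4) ^ 2)) = -2 := by
    decide
  have := key k m
  push_cast
  linear_combination (((k + m).choose k : ZMod 25) ^ 2 *
    ((k + (k + m)).choose k : ZMod 25) ^ 2) * this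

theorem cast_aperyNumber_of_digits (n : ℕ)
    (h1 : 1 ∉ Nat.digits 5 n) (h3 : 3 ∉ Nat.digits 5 n) :
    (aperyNumber n : ZMod 25) = (-2) ^ (Nat.digits 5 n).count 2 := by
  induction n using Nat.strong_induction_on with
  | _ n ih =>
    rcases Nat.eq_zero_or_pos n with rfl | hn
    · simp [aperyNumber]
    rw [Nat.digits_def' (by norm_num) hn] at h1 h3 ⊢
    rw [List.mem_cons, not_or] at h1 h3
    have ih' := ih (n / 5) (by omega) h1.2 h3.2
    have hmod : n % 5 = 0 ∨ n % 5 = 2 ∨ n % 5 = 4 := by omega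
    rcases hmod with h | h | h
    · conv_lhs => rw [show n = 5 * (n / 5) by omega]
      rw [cast_aperyNumber_five_mul, ih', h, List.count_cons_of_ne (by norm_num)]
    · conv_lhs => rw [show n = 5 * (n / 5) + 2 by omega]
      rw [cast_aperyNumber_five_mul_add_two, ih', h, List.count_cons_self, pow_succ']
    · conv_lhs => rw [show n = 5 * (n / 5) + 4 by omega]
      rw [cast_aperyNumber_five_mul_add_four, ih', h, List.count_cons_of_ne (by norm_num)]

theorem theorem3 (n : ℕ)
    (h1 : 1 ∉ Nat.digits 5 n) (h3 : 3 ∉ Nat.digits 5 n) :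
    (aperyNumber n : ℤ) ≡ (-2) ^ (Nat.digits 5 n).count 2 [ZMOD 25] := by
  refine (ZMod.intCast_eq_intCast_iff _ _ 25).1 ?_
  push_cast
  exact cast_aperyNumber_of_digits n h1 h3
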